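/- Let $N\ge 3$ and $K\ge 1$ be integers, let $(x_1,y_1),\dots,(x_N,y_N)$ be training data with real labels $y_i$, let $(x_{\mathrm{test}},y_{\mathrm{test}})$ be a test point, and assume that the data are sorted: $\|x_1-x_{\mathrm{test}}\|\le\dots\le\|x_N-x_{\mathrm{test}}\|$. Write $\mathcal I=\{1,\dots,N\}$. For $S\subseteq\mathcal I$ let $\pi^{(S)}(j)$ be the index of the $j$-th closest point to $x_{\mathrm{test}}$ among those with index in $S$ (ties in distance are broken by the smaller index), and let $$v(\emptyset)=-y_{\mathrm{test}}^2,\qquad v(S)=-\Big(\frac1{\min(K,|S|)}\sum_{j=1}^{\min(K,|S|)}y_{\pi^{(S)}(j)}-y_{\mathrm{test}}\Big)^2\quad(S\neq\emptyset).$$ Let $$\phi_i=\frac1N\sum_{k=1}^N\binom{N-1}{k-1}^{-1}\sum_{S\subseteq\mathcal I\setminus\{i\},\,|S|=k-1}\big[v(S\cup\{i\})-v(S)\big]$$ be the Shapley value of point $i$, and put $\kappa=\min(K,N)$ (so $\kappa=K$ when $K\le N$). Then for all $1\le i\le N-1$ $$\phi_i-\phi_{i+1}=\frac{y_{i+1}-y_i}{N-1}\Big[(y_i+y_{i+1})A_1+2A_2-2y_{\mathrm{test}}A_3\Big],$$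 where $A_1,A_2,A_3$ (depending on $i$) are $$A_1=\sum_{j=1}^{\kappa}\frac1{j^2}+\frac1{\kappa^2}\Big(\frac{(N-1)\min(\kappa,i)}{i}-\kappa\Big),$$ $$\begin{aligned}A_2={}&\frac1{N-2}\Big(\sum_{\ell\in\mathcal I\setminus\{i,i+1\}}y_\ell\Big)\Big(\sum_{j=1}^{\kappa-1}\frac{j}{(j+1)^2}\Big)\\&+\frac1{\kappa^2}\Big[\Big(\sum_{\ell=1}^{i-1}y_\ell\Big)\Big(\frac{(N-1)\min(\kappa,i)\min(\kappa-1,i-1)}{2(i-1)i}-\frac{(\kappa-1)\kappa}{2(N-2)}\Big)\\&\qquad+\sum_{\ell=i+2}^{N}y_\ell\Big(\frac{(N-1)\min(\kappa,\ell-1)\min(\kappa-1,\ell-2)}{2(\ell-1)(\ell-2)}-\frac{(\kappa-1)\kappa}{2(N-2)}\Big)\Big],\end{aligned}$$ $$A_3=\sum_{j=1}^{\kappa}\frac1j+\min(\kappa,i)\frac{N-1}{i\kappa}-1$$ (for $i=1$ the summand of $A_2$ containing the empty sum $\sum_{\ell=1}^{i-1}y_\ell$ is $0$). Moreover $$\phi_N=\frac1N(*)+\frac1N\big[y_{\mathrm{test}}^2-(y_N-y_{\mathrm{test}})^2\big],$$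 where $$\begin{aligned}(*)=\sum_{j=1}^{\kappa-1}\Big[&\frac{2j+1}{j^2(j+1)^2}\Big(\frac{j(j-1)}{(N-1)(N-2)}\Big(\sum_{i=1}^{N-1}y_i\Big)^2+\frac{j(N-j-1)}{(N-1)(N-2)}\sum_{i=1}^{N-1}y_i^2\Big)\\&+\Big(-\frac{2y_N}{(j+1)^2}-\frac{2y_{\mathrm{test}}}{j(j+1)}\Big)\frac{j}{N-1}\sum_{i=1}^{N-1}y_i+\Big(\frac{y_N}{j+1}-2y_{\mathrm{test}}\Big)\Big(-\frac{y_N}{j+1}\Big)\Big].\end{aligned}$$ -/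

import Mathlib

noncomputable section

/-- The Shapley value of player `i` in the game with (finite) player set `I` and utility `v`:
`(1/N) ∑_{k=1}^N (N-1 choose k-1)⁻¹ ∑_{S ⊆ I \ {i}, |S| = k-1} (v (S ∪ {i}) - v S)`,
where `N = |I|`. -/
def shapleyValue (I : Finset ℕ) (v : Finset ℕ → ℝ) (i : ℕ) : ℝ :=
  (1 / (I.card : ℝ)) * ∑ k ∈ Finset.Icc 1 I.card,
    (((I.card - 1).choose (k - 1) : ℕ) : ℝ)⁻¹ *
      ∑ S ∈ (I.erase i).powersetCard (k - 1), (v (insert i S) - v S)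

section KNN

variable {E : Type*} [NormedAddCommGroup E]

/-- `IsCloser x xtest j i`: the data point `j` precedes the data point `i` in the order of
increasing distance to `xtest`; points at equal distance are ordered by their index. -/
def IsCloser (x : ℕ → E) (xtest : E) (j i : ℕ) : Prop :=
  ‖x j - xtest‖ < ‖x i - xtest‖ ∨ (‖x j - xtest‖ = ‖x i - xtest‖ ∧ j < i)

open Classical in
/-- The `min K |S|` nearest neighbours of `xtest` among the data points with index in `S`:
those points of `S` that are preceded by fewer than `K` points of `S`. -/
def nearestNeighbors (K : ℕ) (x : ℕ → E) (xtest : E) (S : Finset ℕ) : Finset ℕ :=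
  S.filter fun i => (S.filter fun j => IsCloser x xtest j i).card < K

/-- The soft-label KNN regression utility: minus the squared error of the mean label of the
`min K |S|` nearest neighbours (the prediction on the empty set being `0`). -/
def knnRegressionUtility (K : ℕ) (x : ℕ → E) (y : ℕ → ℝ) (xtest : E) (ytest : ℝ)
    (S : Finset ℕ) : ℝ :=
  if S.card = 0 then -ytest ^ 2
  else -((1 / ((min K S.card : ℕ) : ℝ)) * ∑ i ∈ nearestNeighbors K x xtest S, y i - ytest) ^ 2

end KNN

/-- `A₁ = ∑_{j=1}^K 1/j² + (1/K²) ((N-1) min(K,i)/i - K)`. -/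
def coeffA₁ (N K i : ℕ) : ℝ :=
  (∑ j ∈ Finset.Icc 1 K, 1 / (j : ℝ) ^ 2)
    + 1 / (K : ℝ) ^ 2 * (((N : ℝ) - 1) * min (K : ℝ) i / i - K)

/-- The coefficient `A₂`; for `i = 1` the term with the denominator `(i-1) i` is multiplied by
the empty sum `∑_{ℓ=1}^{i-1} y_ℓ = 0`. -/
def coeffA₂ (N K : ℕ) (y : ℕ → ℝ) (i : ℕ) : ℝ :=
  1 / ((N : ℝ) - 2) * (∑ l ∈ Finset.Icc 1 N \ {i, i + 1}, y l)
      * (∑ j ∈ Finset.Icc 1 (K - 1), (j : ℝ) / ((j : ℝ) + 1) ^ 2)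
    + 1 / (K : ℝ) ^ 2 *
      ((∑ l ∈ Finset.Icc 1 (i - 1), y l) *
          (((N : ℝ) - 1) * min (K : ℝ) i * min ((K : ℝ) - 1) ((i : ℝ) - 1)
              / (2 * ((i : ℝ) - 1) * i)
            - ((K : ℝ) - 1) * K / (2 * ((N : ℝ) - 2)))
        + ∑ l ∈ Finset.Icc (i + 2) N, y l *
          (((N : ℝ) - 1) * min (K : ℝ) ((l : ℝ) - 1) * min ((K : ℝ) - 1) ((l : ℝ) - 2)
              / (2 * ((l : ℝ) - 1) * ((l : ℝ) - 2))
            - ((K : ℝ) - 1) * K / (2 * ((N : ℝ) - 2))))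

/-- `A₃ = ∑_{j=1}^K 1/j + min(K,i) (N-1)/(iK) - 1`. -/
def coeffA₃ (N K i : ℕ) : ℝ :=
  (∑ j ∈ Finset.Icc 1 K, 1 / (j : ℝ)) + min (K : ℝ) i * (((N : ℝ) - 1) / ((i : ℝ) * K)) - 1

/-- The sum over `j = 1, …, K-1` in the closed form of the Shapley value of the farthest point. -/
def lastPointSum (N K : ℕ) (y : ℕ → ℝ) (ytest : ℝ) : ℝ :=
  ∑ j ∈ Finset.Icc 1 (K - 1),
    ((2 * (j : ℝ) + 1) / ((j : ℝ) ^ 2 * ((j : ℝ) + 1) ^ 2) *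
        ((j : ℝ) * ((j : ℝ) - 1) / (((N : ℝ) - 1) * ((N : ℝ) - 2))
            * (∑ i ∈ Finset.Icc 1 (N - 1), y i) ^ 2
          + (j : ℝ) * ((N : ℝ) - j - 1) / (((N : ℝ) - 1) * ((N : ℝ) - 2))
            * ∑ i ∈ Finset.Icc 1 (N - 1), y i ^ 2)
      + (-(2 * y N) / ((j : ℝ) + 1) ^ 2 - 2 * ytest / ((j : ℝ) * ((j : ℝ) + 1)))
          * ((j : ℝ) / ((N : ℝ) - 1)) * ∑ i ∈ Finset.Icc 1 (N - 1), y i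
      + (y N / ((j : ℝ) + 1) - 2 * ytest) * (-(y N / ((j : ℝ) + 1))))

end

open Finset

/-! Up to normalisation, `powersetSum` is an expectation over a random subset whose size is uniform
and which is uniform given its size. A Shapley value is such an average of marginal contributions,
and `shapleyValue_insert_insert_sub` turns a difference of two Shapley values into an average of `v
(insert i S) - v (insert j S)` over sets avoiding both points.

For neighbours `i`, `i + 1` in the distance order, every such `S` has the same points before either
of them. The utilities therefore differ only if fewer than `K` points of `S` precede `i`, and then a
difference of squares factors out `y (i + 1) - y i` (`sortedUtility_insert_sub`). What remains are
averages of a function of `S.card` times an indicator depending on the number of points of `S`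
before `i`. They are decoupled by subtracting the constant value that the function takes for large
`S`: the remainder lives on small `S`, where the indicator is 1, and the constant part needs only
the law of `S ∩ Y`, which is again uniform in size (`powersetSum_inter`).

The farthest point changes the prediction only when `S.card < K`, and then all of `S` is averaged.
Its value thus reduces to the first two moments of the label sum of a random subset of given size.
-/

/-! ### Averages over subsets, uniform in size. -/

/-- The sum of `g` over the subsets of `X`, those of each given size being weighted equally with
total weight one. -/
noncomputable def powersetSum (X : Finset ℕ) (g : Finset ℕ → ℝ) : ℝ :=
  ∑ S ∈ X.powerset, ((X.card.choose S.card : ℕ) : ℝ)⁻¹ * g S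

lemma powersetSum_congr {X : Finset ℕ} {g h : Finset ℕ → ℝ} (H : ∀ S ⊆ X, g S = h S) :
    powersetSum X g = powersetSum X h :=
  sum_congr rfl fun S hS => by rw [H S (mem_powerset.1 hS)]

lemma powersetSum_add (X : Finset ℕ) (g h : Finset ℕ → ℝ) :
    powersetSum X (fun S => g S + h S) = powersetSum X g + powersetSum X h := by
  simp only [powersetSum, mul_add, sum_add_distrib]

lemma powersetSum_const_mul (X : Finset ℕ) (c : ℝ) (g : Finset ℕ → ℝ) :
    powersetSum X (fun S => c * g S) = c * powersetSum X g := by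
  simp only [powersetSum, mul_sum]
  exact sum_congr rfl fun S _ => by ring

lemma powersetSum_sum (X : Finset ℕ) {ι : Type*} (A : Finset ι) (g : ι → Finset ℕ → ℝ) :
    powersetSum X (fun S => ∑ a ∈ A, g a S) = ∑ a ∈ A, powersetSum X (g a) := by
  simp only [powersetSum, mul_sum]
  exact sum_comm

lemma powersetSum_card (X : Finset ℕ) (h : ℕ → ℝ) :
    powersetSum X (fun S => h S.card) = ∑ s ∈ range (X.card + 1), h s := by
  rw [powersetSum, sum_powerset]
  refine sum_congr rfl fun s hs => ?_
  rw [sum_congr rfl (g := fun _ => ((X.card.choose s : ℕ) : ℝ)⁻¹ * h s)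
    (fun S hS => by rw [(mem_powersetCard.1 hS).2]), sum_const, card_powersetCard, nsmul_eq_mul]
  have : ((X.card.choose s : ℕ) : ℝ) ≠ 0 := by
    exact_mod_cast (Nat.choose_pos (Nat.lt_succ_iff.1 (mem_range.1 hs))).ne'
  field_simp

lemma inv_choose_succ_succ (n s : ℕ) (h : s ≤ n) :
    (((n + 1).choose (s + 1) : ℕ) : ℝ)⁻¹ = ((n.choose s : ℕ) : ℝ)⁻¹ * (((s : ℝ) + 1) / (n + 1)) := by
  have h1 : ((n.choose s : ℕ) : ℝ) ≠ 0 := by exact_mod_cast (Nat.choose_pos h).ne'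
  have h2 : (((n + 1).choose (s + 1) : ℕ) : ℝ) ≠ 0 := by
    exact_mod_cast (Nat.choose_pos (Nat.succ_le_succ h)).ne'
  have h3 : ((n : ℝ) + 1) * (n.choose s : ℕ) = ((n + 1).choose (s + 1) : ℕ) * ((s : ℝ) + 1) := by
    exact_mod_cast Nat.add_one_mul_choose_eq n s
  have h4 : (n : ℝ) + 1 ≠ 0 := by positivity
  field_simp
  linarith

lemma inv_choose_succ (n s : ℕ) (h : s ≤ n) :
    (((n + 1).choose s : ℕ) : ℝ)⁻¹
      = ((n.choose s : ℕ) : ℝ)⁻¹ * (((n : ℝ) + 1 - s) / (n + 1)) := by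
  have := inv_choose_succ_succ n (n - s) (Nat.sub_le _ _)
  rw [Nat.choose_symm h, ← Nat.sub_add_comm h, Nat.choose_symm (by omega), Nat.cast_sub (by omega)]
    at this
  rw [this]
  ring

lemma inv_choose_add_inv_choose (n s : ℕ) (h : s ≤ n) :
    (((n + 1).choose s : ℕ) : ℝ)⁻¹ + (((n + 1).choose (s + 1) : ℕ) : ℝ)⁻¹
      = ((n : ℝ) + 2) / (n + 1) * ((n.choose s : ℕ) : ℝ)⁻¹ := by
  rw [inv_choose_succ n s h, inv_choose_succ_succ n s h]
  ring

/-- Pair `S` with `insert a S`: their two weights add up to a fixed multiple of the weight of `S` in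
`X`. -/
lemma powersetSum_insert_of_invariant {X : Finset ℕ} {a : ℕ} (ha : a ∉ X) (g : Finset ℕ → ℝ)
    (hg : ∀ S ⊆ X, g (insert a S) = g S) :
    powersetSum (insert a X) g = ((X.card : ℝ) + 2) / (X.card + 1) * powersetSum X g := by
  rw [powersetSum, sum_powerset_insert ha, ← sum_add_distrib, powersetSum, mul_sum]
  refine sum_congr rfl fun S hS => ?_
  have hS := mem_powerset.1 hS
  rw [hg S hS, card_insert_of_notMem ha, card_insert_of_notMem (fun h => ha (hS h)), ← add_mul,
    inv_choose_add_inv_choose _ _ (card_le_card hS), mul_assoc]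

/-- Marginals of the uniform-in-size weights are again uniform in size. -/
lemma powersetSum_inter {X Y : Finset ℕ} (hYX : Y ⊆ X) (g : Finset ℕ → ℝ) :
    powersetSum X (fun S => g (S ∩ Y)) = ((X.card : ℝ) + 1) / (Y.card + 1) * powersetSum Y g := by
  obtain ⟨Z, hZ, rfl⟩ : ∃ Z, Disjoint Y Z ∧ X = Z ∪ Y :=
    ⟨X \ Y, disjoint_sdiff, (sdiff_union_of_subset hYX).symm⟩
  clear hYX
  -- Removing the points outside `Y` one at a time gives factors `(n + 2) / (n + 1)`, which
  -- telescope.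
  induction Z using Finset.induction_on with
  | empty =>
    have : (Y.card : ℝ) + 1 ≠ 0 := by positivity
    rw [empty_union, div_self this, one_mul]
    exact powersetSum_congr fun S hS => by rw [inter_eq_left.2 hS]
  | insert a Z haZ ih =>
    rw [disjoint_insert_right] at hZ
    have ha : a ∉ Z ∪ Y := by simp [haZ, hZ.1]
    rw [insert_union, powersetSum_insert_of_invariant ha _
      (fun S _ => by rw [insert_inter_of_notMem hZ.1]), ih hZ.2, card_insert_of_notMem ha]
    have h1 : ((Z ∪ Y).card : ℝ) + 1 ≠ 0 := by positivity
    push_cast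
    field_simp
    ring

/-- The new factor is the probability that a random set of size `S.card + 1` contains `a`. -/
lemma powersetSum_ite_mem_insert {X : Finset ℕ} {a : ℕ} (ha : a ∉ X) (g : Finset ℕ → ℝ) :
    powersetSum (insert a X) (fun S => if a ∈ S then g S else 0)
      = powersetSum X (fun S => ((S.card : ℝ) + 1) / (X.card + 1) * g (insert a S)) := by
  rw [powersetSum, sum_powerset_insert ha, ← sum_add_distrib, powersetSum]
  refine sum_congr rfl fun S hS => ?_
  have hS := mem_powerset.1 hS
  have haS : a ∉ S := fun h => ha (hS h)
  rw [if_neg haS, if_pos (mem_insert_self _ _), card_insert_of_notMem ha,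
    card_insert_of_notMem haS, inv_choose_succ_succ _ _ (card_le_card hS)]
  ring

lemma powersetSum_ite_mem_card {X : Finset ℕ} {a : ℕ} (ha : a ∈ X) (h : ℕ → ℝ) :
    powersetSum X (fun S => if a ∈ S then h S.card else 0)
      = ∑ s ∈ range (X.card + 1), (s : ℝ) / X.card * h s := by
  obtain ⟨X, haX, rfl⟩ : ∃ Z, a ∉ Z ∧ X = insert a Z := ⟨X.erase a, by simp, by simp [ha]⟩
  rw [powersetSum_ite_mem_insert haX (fun S => h S.card), card_insert_of_notMem haX, sum_range_succ']
  have := powersetSum_card X (fun s => ((s : ℝ) + 1) / (X.card + 1) * h (s + 1))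
  simp only [Nat.cast_zero, zero_div, zero_mul, add_zero, Nat.cast_add, Nat.cast_one]
  rw [← this]
  exact powersetSum_congr fun S hS => by rw [card_insert_of_notMem (fun h => haX (hS h))]

lemma powersetSum_ite_mem_mem_card {X : Finset ℕ} {a b : ℕ} (ha : a ∈ X) (hb : b ∈ X) (hab : b ≠ a)
    (h : ℕ → ℝ) :
    powersetSum X (fun S => if a ∈ S then (if b ∈ S then h S.card else 0) else 0)
      = ∑ s ∈ range (X.card + 1),
          (s : ℝ) * ((s : ℝ) - 1) / (X.card * ((X.card : ℝ) - 1)) * h s := by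
  obtain ⟨X, haX, rfl⟩ : ∃ Z, a ∉ Z ∧ X = insert a Z := ⟨X.erase a, by simp, by simp [ha]⟩
  have hb : b ∈ X := mem_of_mem_insert_of_ne hb hab
  rw [powersetSum_ite_mem_insert haX (fun S => if b ∈ S then h S.card else 0),
    card_insert_of_notMem haX, sum_range_succ']
  have := powersetSum_ite_mem_card hb (fun s => ((s : ℝ) + 1) / (X.card + 1) * h (s + 1))
  rw [powersetSum_congr (h := fun S => if b ∈ S then
    ((S.card : ℝ) + 1) / (X.card + 1) * h (S.card + 1) else 0), this]
  · simp only [Nat.cast_zero, zero_div, zero_mul, add_zero, Nat.cast_add, Nat.cast_one,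
      add_sub_cancel_right]
    refine sum_congr rfl fun s _ => ?_
    rw [← mul_assoc, div_mul_div_comm, mul_comm (s : ℝ), mul_comm (X.card : ℝ)]
  · intro S hS
    simp [card_insert_of_notMem (fun h => haX (hS h)), hab]

/-- The second moment of the sum of `y` over a random subset of given size. -/
lemma powersetSum_card_mul_sum_sq (X : Finset ℕ) (y : ℕ → ℝ) (h : ℕ → ℝ) :
    powersetSum X (fun S => h S.card * (∑ l ∈ S, y l) ^ 2)
      = ∑ s ∈ range (X.card + 1), h s *
          ((s : ℝ) * ((s : ℝ) - 1) / (X.card * ((X.card : ℝ) - 1)) * (∑ l ∈ X, y l) ^ 2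
            + ((s : ℝ) / X.card - (s : ℝ) * ((s : ℝ) - 1) / (X.card * ((X.card : ℝ) - 1)))
              * ∑ l ∈ X, y l ^ 2) := by
  set p : ℕ → ℝ := fun s => (s : ℝ) / X.card
  set q : ℕ → ℝ := fun s => (s : ℝ) * ((s : ℝ) - 1) / (X.card * ((X.card : ℝ) - 1))
  -- Here `p` and `q` are the probabilities of containing one point and two distinct points. Writing
  -- the diagonal weight as `q + (p - q)` completes the off-diagonal sum to a full square; `q`
  -- cancels on the diagonal, so its zero denominator for `X.card = 1` is harmless.
  have key : ∀ a ∈ X, ∀ b ∈ X,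
      powersetSum X (fun S => y a * y b * if a ∈ S then (if b ∈ S then h S.card else 0) else 0)
        = ∑ s ∈ range (X.card + 1),
          (h s * q s * (y a * y b) + if b = a then h s * (p s - q s) * (y a * y b) else 0) := by
    intro a ha b hb
    rw [powersetSum_const_mul, sum_add_distrib]
    by_cases hab : b = a
    · subst hab
      rw [powersetSum_congr (h := fun S => if b ∈ S then h S.card else 0)
        (fun S _ => by by_cases hbS : b ∈ S <;> simp [hbS]),
        powersetSum_ite_mem_card ha, mul_sum, ← sum_add_distrib]
      refine sum_congr rfl fun s _ => ?_
      simp only [if_true, p, q]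
      ring
    · rw [powersetSum_ite_mem_mem_card ha hb hab, mul_sum]
      simp only [if_neg hab, sum_const_zero, add_zero, q]
      exact sum_congr rfl fun s _ => by ring
  rw [powersetSum_congr (h := fun S => ∑ a ∈ X, ∑ b ∈ X,
    y a * y b * if a ∈ S then (if b ∈ S then h S.card else 0) else 0)]
  · rw [powersetSum_sum, sum_congr rfl (fun a ha => by
      rw [powersetSum_sum, sum_congr rfl (fun b hb => key a ha b hb), sum_comm]), sum_comm]
    refine sum_congr rfl fun s _ => ?_
    simp only [sum_add_distrib, ← mul_sum]
    rw [mul_add, ← mul_assoc, ← mul_assoc, sq, sum_mul_sum]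
    congr 1
    · simp only [mul_sum, q]
    · rw [mul_sum]
      refine sum_congr rfl fun a ha => ?_
      rw [sum_ite_eq' X a]
      simp only [ha, if_true, p, q]
      ring
  · intro S hS
    have e : ∑ l ∈ S, y l = ∑ l ∈ X, if l ∈ S then y l else 0 := by
      rw [← sum_filter, filter_mem_eq_inter, inter_eq_right.2 hS]
    rw [e, sq, sum_mul_sum, mul_sum]
    refine sum_congr rfl fun a _ => ?_
    rw [mul_sum]
    refine sum_congr rfl fun b _ => ?_
    split_ifs <;> ring

/-- The first moment of the sum of `y` over a random subset of given size. -/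
lemma powersetSum_card_mul_sum (X : Finset ℕ) (y : ℕ → ℝ) (h : ℕ → ℝ) :
    powersetSum X (fun S => h S.card * ∑ l ∈ S, y l)
      = ∑ s ∈ range (X.card + 1), h s * ((s : ℝ) / X.card * ∑ l ∈ X, y l) := by
  rw [powersetSum_congr (h := fun S => ∑ a ∈ X, y a * if a ∈ S then h S.card else 0)]
  · rw [powersetSum_sum, sum_congr rfl (fun a ha => by
      rw [powersetSum_const_mul, powersetSum_ite_mem_card ha, mul_sum]), sum_comm]
    refine sum_congr rfl fun s _ => ?_
    simp only [mul_sum]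
    exact sum_congr rfl fun a _ => by ring
  · intro S hS
    have e : ∑ l ∈ S, y l = ∑ l ∈ X, if l ∈ S then y l else 0 := by
      rw [← sum_filter, filter_mem_eq_inter, inter_eq_right.2 hS]
    rw [e, mul_sum]
    refine sum_congr rfl fun a _ => ?_
    split_ifs <;> ring

/-! ### Shapley values as subset averages. -/

lemma sum_Icc_one_eq_sum_range (n : ℕ) (f : ℕ → ℝ) :
    ∑ k ∈ Icc 1 n, f k = ∑ s ∈ range n, f (s + 1) := by
  induction n with
  | zero => simp
  | succ n ih => rw [sum_Icc_succ_top (by omega), ih, sum_range_succ]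

lemma shapleyValue_eq_powersetSum {I : Finset ℕ} {i : ℕ} (hi : i ∈ I) (v : Finset ℕ → ℝ) :
    shapleyValue I v i
      = 1 / (I.card : ℝ) * powersetSum (I.erase i) (fun S => v (insert i S) - v S) := by
  obtain ⟨X, ha, rfl⟩ : ∃ Z, i ∉ Z ∧ I = insert i Z := ⟨I.erase i, by simp, by simp [hi]⟩
  rw [shapleyValue, erase_insert ha, powersetSum, sum_powerset, card_insert_of_notMem ha]
  congr 1
  rw [sum_Icc_one_eq_sum_range]
  refine sum_congr rfl fun s _ => ?_
  simp only [Nat.add_sub_cancel]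
  rw [mul_sum]
  exact sum_congr rfl fun S hS => by rw [(mem_powersetCard.1 hS).2]

lemma shapleyValue_congr {I : Finset ℕ} {i : ℕ} (hi : i ∈ I) {v w : Finset ℕ → ℝ}
    (h : ∀ S ⊆ I, v S = w S) : shapleyValue I v i = shapleyValue I w i := by
  rw [shapleyValue_eq_powersetSum hi, shapleyValue_eq_powersetSum hi]
  congr 1
  refine powersetSum_congr fun S hS => ?_
  have hS := hS.trans (erase_subset _ _)
  rw [h S hS, h _ (insert_subset hi hS)]

/-- Sets without the other player and sets containing it both contribute `v (insert i S) - v (insert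
j S)`, because the terms `v S` and `v (insert i (insert j S))` cancel. The two weights merge by
`inv_choose_add_inv_choose`. -/
lemma shapleyValue_insert_insert_sub {X : Finset ℕ} {i j : ℕ} (hi : i ∉ X) (hj : j ∉ X)
    (hij : i ≠ j) (v : Finset ℕ → ℝ) :
    shapleyValue (insert i (insert j X)) v i - shapleyValue (insert i (insert j X)) v j
      = 1 / ((X.card : ℝ) + 1) * powersetSum X (fun S => v (insert i S) - v (insert j S)) := by
  have hi' : i ∉ insert j X := by simp [hi, hij]
  have hj' : j ∉ insert i X := by simp [hj, hij.symm]
  rw [shapleyValue_eq_powersetSum (by simp), shapleyValue_eq_powersetSum (by simp), erase_insert hi',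
    Finset.insert_comm i j X, erase_insert hj', card_insert_of_notMem hj', card_insert_of_notMem hi,
    powersetSum, powersetSum, powersetSum, sum_powerset_insert hi, sum_powerset_insert hj,
    card_insert_of_notMem hi, card_insert_of_notMem hj, ← mul_sub, ← sum_add_distrib,
    ← sum_add_distrib, ← sum_sub_distrib, mul_sum, mul_sum]
  refine sum_congr rfl fun S hS => ?_
  have hS := mem_powerset.1 hS
  rw [card_insert_of_notMem (fun h => hi (hS h)), card_insert_of_notMem (fun h => hj (hS h)),
    Finset.insert_comm j i S]
  have := inv_choose_add_inv_choose _ _ (card_le_card hS)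
  have h1 : (X.card : ℝ) + 1 ≠ 0 := by positivity
  have h2 : (X.card : ℝ) + 2 ≠ 0 := by positivity
  have e : ((X.card.choose S.card : ℕ) : ℝ)⁻¹ = ((X.card : ℝ) + 1) / (X.card + 2) *
    ((((X.card + 1).choose S.card : ℕ) : ℝ)⁻¹
      + (((X.card + 1).choose (S.card + 1) : ℕ) : ℝ)⁻¹) := by
    rw [this, ← mul_assoc, div_mul_div_comm, mul_comm, mul_comm ((X.card : ℝ) + 1),
      div_self (by positivity), mul_one]
  rw [e]
  push_cast
  generalize (((X.card + 1).choose S.card : ℕ) : ℝ)⁻¹ = a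
  generalize (((X.card + 1).choose (S.card + 1) : ℕ) : ℝ)⁻¹ = b
  have e2 : (X.card : ℝ) + 1 + 1 = X.card + 2 := by ring
  rw [e2]
  field_simp
  ring

/-! ### Nearest neighbours as smallest indices. -/

/-- The `K` smallest elements of `S`. -/
def smallest (K : ℕ) (S : Finset ℕ) : Finset ℕ :=
  S.filter fun i => (S.filter (· < i)).card < K

lemma mem_smallest {K : ℕ} {S : Finset ℕ} {l : ℕ} :
    l ∈ smallest K S ↔ l ∈ S ∧ (S.filter (· < l)).card < K := by
  simp [smallest]

lemma card_filter_lt_lt_card_filter_lt {S : Finset ℕ} {l i : ℕ} (hl : l ∈ S) (hli : l < i) :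
    (S.filter (· < l)).card < (S.filter (· < i)).card := by
  refine card_lt_card ((ssubset_iff_of_subset fun j hj => ?_).2 ⟨l, ?_, ?_⟩)
  · simp only [mem_filter] at hj ⊢
    exact ⟨hj.1, hj.2.trans hli⟩
  · simp [hl, hli]
  · simp

lemma card_filter_lt_mono (S : Finset ℕ) {l i : ℕ} (hli : l ≤ i) :
    (S.filter (· < l)).card ≤ (S.filter (· < i)).card :=
  card_le_card fun j hj => by
    simp only [mem_filter] at hj ⊢
    exact ⟨hj.1, hj.2.trans_le hli⟩

lemma smallest_of_card_le {K : ℕ} {S : Finset ℕ} (h : S.card ≤ K) : smallest K S = S := by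
  refine filter_true_of_mem fun l hl => lt_of_lt_of_le (card_lt_card ?_) h
  exact (ssubset_iff_of_subset (filter_subset _ _)).2 ⟨l, hl, by simp⟩

lemma card_filter_lt_insert {S : Finset ℕ} {i : ℕ} (hi : i ∉ S) (l : ℕ) :
    ((insert i S).filter (· < l)).card = (S.filter (· < l)).card + if i < l then 1 else 0 := by
  rw [filter_insert]
  split_ifs with h
  · rw [card_insert_of_notMem (by simp [hi])]
  · rfl

/-- The inserted point takes one of the `k + 1` places and leaves `k` for `S`, whichever side of `i`
its points lie on. -/
lemma smallest_insert_of_lt {k : ℕ} {S : Finset ℕ} {i : ℕ} (hi : i ∉ S)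
    (h : (S.filter (· < i)).card < k + 1) :
    smallest (k + 1) (insert i S) = insert i (smallest k S) := by
  ext l
  rw [mem_smallest, mem_insert, mem_insert, mem_smallest, card_filter_lt_insert hi]
  constructor
  · rintro ⟨rfl | hl, h2⟩
    · exact Or.inl rfl
    · refine Or.inr ⟨hl, ?_⟩
      rcases lt_trichotomy i l with h3 | rfl | h3
      · rw [if_pos h3] at h2; omega
      · exact absurd hl hi
      · have := card_filter_lt_lt_card_filter_lt hl h3; omega
  · rintro (rfl | ⟨hl, h2⟩)
    · simpa using h
    · refine ⟨Or.inr hl, ?_⟩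
      split_ifs <;> omega

lemma smallest_insert_of_le {K : ℕ} {S : Finset ℕ} {i : ℕ} (hi : i ∉ S)
    (h : K ≤ (S.filter (· < i)).card) :
    smallest K (insert i S) = smallest K S := by
  ext l
  rw [mem_smallest, mem_insert, mem_smallest, card_filter_lt_insert hi]
  constructor
  · rintro ⟨rfl | hl, h2⟩
    · simp only [lt_irrefl, if_false] at h2; omega
    · exact ⟨hl, by omega⟩
  · rintro ⟨hl, h2⟩
    refine ⟨Or.inr hl, ?_⟩
    split_ifs with h3
    · have := card_filter_lt_mono S h3.le; omega
    · omega

/-- The utility of the KNN regression for points indexed by increasing distance. -/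
noncomputable def sortedUtility (K : ℕ) (y : ℕ → ℝ) (t : ℝ) (S : Finset ℕ) : ℝ :=
  if S.card = 0 then -t ^ 2
  else -((1 / ((min K S.card : ℕ) : ℝ)) * ∑ i ∈ smallest K S, y i - t) ^ 2

lemma isCloser_iff_lt {E : Type*} [NormedAddCommGroup E] {N : ℕ} {x : ℕ → E} {xtest : E}
    (hsorted : MonotoneOn (fun i => ‖x i - xtest‖) (Set.Icc 1 N)) {j i : ℕ}
    (hj : j ∈ Set.Icc 1 N) (hi : i ∈ Set.Icc 1 N) : IsCloser x xtest j i ↔ j < i := by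
  constructor
  · rintro (h | h)
    · by_contra! h2
      exact absurd (hsorted hi hj h2) (not_le.2 h)
    · exact h.2
  · intro h
    rcases (hsorted hj hi h.le).lt_or_eq with h2 | h2
    · exact Or.inl h2
    · exact Or.inr ⟨h2, h⟩

/-- Sortedness with the index tie-break makes the distance order the order of indices. Truncating
`K` at `N` is harmless, since no subset has more than `N` points. -/
lemma knnRegressionUtility_eq_sortedUtility {E : Type*} [NormedAddCommGroup E] {N : ℕ} (K : ℕ)
    {x : ℕ → E} (y : ℕ → ℝ) {xtest : E} (t : ℝ)
    (hsorted : MonotoneOn (fun i => ‖x i - xtest‖) (Set.Icc 1 N))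
    {S : Finset ℕ} (hS : S ⊆ Icc 1 N) :
    knnRegressionUtility K x y xtest t S = sortedUtility (min K N) y t S := by
  have hmem : ∀ i ∈ S, i ∈ Set.Icc 1 N := fun i hi => by simpa using hS hi
  have hcard : S.card ≤ N := by simpa using card_le_card hS
  have hnn : nearestNeighbors K x xtest S = smallest K S := by
    classical
    refine filter_congr fun i hi => ?_
    rw [filter_congr (q := fun j => j < i) fun j hj => isCloser_iff_lt hsorted (hmem j hj) (hmem i hi)]
  have hsm : smallest K S = smallest (min K N) S := by
    rcases le_total K N with h | h
    · rw [min_eq_left h]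
    · rw [min_eq_right h, smallest_of_card_le hcard, smallest_of_card_le (hcard.trans h)]
  rw [knnRegressionUtility, sortedUtility, hnn, hsm, min_assoc, min_eq_right hcard]

lemma sortedUtility_insert_sub {k : ℕ} {S : Finset ℕ} {i : ℕ} (hi : i ∉ S) (hi' : i + 1 ∉ S)
    (y : ℕ → ℝ) (t : ℝ) :
    sortedUtility (k + 1) y t (insert i S) - sortedUtility (k + 1) y t (insert (i + 1) S)
      = (y (i + 1) - y i) * ((y i + y (i + 1)) *
          (if (S.filter (· < i)).card < k + 1 then (1 / ((min (k + 1) (S.card + 1) : ℕ) : ℝ)) ^ 2 else 0)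
        + 2 * (if (S.filter (· < i)).card < k + 1 then
            (1 / ((min (k + 1) (S.card + 1) : ℕ) : ℝ)) ^ 2 * ∑ l ∈ smallest k S, y l else 0)
        - 2 * t * (if (S.filter (· < i)).card < k + 1 then
            1 / ((min (k + 1) (S.card + 1) : ℕ) : ℝ) else 0)) := by
  have e : S.filter (· < i + 1) = S.filter (· < i) := by
    refine filter_congr fun j hj => ?_
    have : j ≠ i := fun h => hi (h ▸ hj)
    omega
  rw [sortedUtility, sortedUtility, card_insert_of_notMem hi, card_insert_of_notMem hi',
    if_neg (Nat.succ_ne_zero _), if_neg (Nat.succ_ne_zero _)]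
  by_cases h : (S.filter (· < i)).card < k + 1
  · rw [smallest_insert_of_lt hi h, smallest_insert_of_lt hi' (e ▸ h),
      sum_insert (fun h => hi (mem_smallest.1 h).1), sum_insert (fun h => hi' (mem_smallest.1 h).1)]
    simp only [if_pos h]
    ring
  · rw [smallest_insert_of_le hi (not_lt.1 h), smallest_insert_of_le hi' (e ▸ not_lt.1 h)]
    simp only [if_neg h]
    ring

/-! ### Decoupling the size of a set from the rank of a point. -/

lemma sum_range_ite_lt {k n : ℕ} (h : k ≤ n) (f : ℕ → ℝ) :
    ∑ s ∈ range n, (if s < k then f s else 0) = ∑ s ∈ range k, f s := by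
  rw [← sum_filter]
  congr 1
  ext s
  simp only [mem_filter, mem_range]
  omega

lemma sum_range_cast (n : ℕ) : ∑ s ∈ range n, (s : ℝ) = n * ((n : ℝ) - 1) / 2 := by
  induction n with
  | zero => simp
  | succ n ih => rw [sum_range_succ, ih]; push_cast; ring

lemma sum_range_ite_lt_min (k n : ℕ) (f : ℕ → ℝ) :
    ∑ s ∈ range n, (if s < k then f s else 0) = ∑ s ∈ range (min k n), f s := by
  rw [← sum_range_ite_lt (min_le_right k n)]
  refine sum_congr rfl fun s hs => ?_
  have := mem_range.1 hs
  simp [this]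

lemma powersetSum_ite_card_inter {X Y : Finset ℕ} (hYX : Y ⊆ X) (K : ℕ) :
    powersetSum X (fun S => if (S ∩ Y).card < K then 1 else 0)
      = ((X.card : ℝ) + 1) * ((min K (Y.card + 1) : ℕ) : ℝ) / ((Y.card : ℝ) + 1) := by
  rw [powersetSum_inter hYX (fun S => if S.card < K then 1 else 0),
    powersetSum_card Y (fun s => if s < K then 1 else 0), sum_range_ite_lt_min]
  simp only [sum_const, card_range, nsmul_eq_mul, mul_one]
  ring

/-- With `m = min K (Y.card + 1)` admissible sizes, summing `s / Y.card` over `s < m` gives `m * (m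
- 1) / (2 * Y.card)`; this is the source of the product of two minima in `coeffA₂`. -/
lemma powersetSum_ite_mem_card_inter {X Y : Finset ℕ} (hYX : Y ⊆ X) {l : ℕ} (hl : l ∈ Y) (K : ℕ) :
    powersetSum X (fun S => if l ∈ S ∧ (S ∩ Y).card < K then 1 else 0)
      = ((X.card : ℝ) + 1) * ((min K (Y.card + 1) : ℕ) : ℝ)
          * (((min K (Y.card + 1) : ℕ) : ℝ) - 1) / (2 * Y.card * ((Y.card : ℝ) + 1)) := by
  have h1 := powersetSum_inter hYX
    (fun S => if l ∈ S then (if S.card < K then 1 else 0) else 0)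
  have h2 := powersetSum_ite_mem_card hl (fun s => if s < K then 1 else 0)
  rw [powersetSum_congr (h := fun S => if l ∈ S ∩ Y then
    (if (S ∩ Y).card < K then 1 else 0) else 0) (fun S _ => by simp [hl, ite_and]), h1, h2]
  have h3 : ∀ s : ℕ, (s : ℝ) / Y.card * (if s < K then 1 else 0)
      = (Y.card : ℝ)⁻¹ * if s < K then (s : ℝ) else 0 := fun s => by split_ifs <;> ring
  simp only [h3]
  rw [← mul_sum, sum_range_ite_lt_min, sum_range_cast]
  simp only [div_eq_mul_inv, mul_inv]
  ring

/-- Split `f = c + (f - c)`. The second part vanishes once `k ≤ S.card`; below that the condition on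
`S ∩ Y` holds automatically. -/
lemma powersetSum_ite_card_inter_mul {X Y : Finset ℕ} (hYX : Y ⊆ X) {k : ℕ} (hk : k ≤ X.card + 1)
    {f : ℕ → ℝ} {c : ℝ} (hf : ∀ s, k ≤ s → f s = c) :
    powersetSum X (fun S => if (S ∩ Y).card < k + 1 then f S.card else 0)
      = c * (((X.card : ℝ) + 1) * ((min (k + 1) (Y.card + 1) : ℕ) : ℝ) / ((Y.card : ℝ) + 1))
        + ∑ s ∈ range k, (f s - c) := by
  rw [← powersetSum_ite_card_inter hYX, ← sum_range_ite_lt hk,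
    ← powersetSum_card X (fun s => if s < k then f s - c else 0), ← powersetSum_const_mul,
    ← powersetSum_add]
  refine powersetSum_congr fun S _ => ?_
  have h1 : (S ∩ Y).card ≤ S.card := card_le_card inter_subset_left
  by_cases h : S.card < k
  · rw [if_pos (by omega), if_pos (by omega), if_pos h]; ring
  · rw [if_neg h, hf _ (not_lt.1 h)]; split_ifs <;> ring

lemma powersetSum_ite_card_inter_mul_sum {X Y : Finset ℕ} {k : ℕ}
    (hk : k ≤ X.card + 1) {f : ℕ → ℝ} {c : ℝ} (hf : ∀ s, k ≤ s → f s = c) (y : ℕ → ℝ) :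
    powersetSum X (fun S => if (S ∩ Y).card < k + 1 then
        f S.card * ∑ l ∈ smallest k S, y l else 0)
      = ∑ l ∈ X, y l * (c * powersetSum X (fun S =>
            if (S ∩ Y).card < k + 1 ∧ l ∈ smallest k S then 1 else 0)
          + ∑ s ∈ range k, (s : ℝ) / X.card * (f s - c)) := by
  rw [powersetSum_congr (h := fun S => ∑ l ∈ X, y l *
    (c * (if (S ∩ Y).card < k + 1 ∧ l ∈ smallest k S then 1 else 0)
      + if l ∈ S then (if S.card < k then f S.card - c else 0) else 0)), powersetSum_sum]
  · refine sum_congr rfl fun l hl => ?_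
    rw [powersetSum_const_mul, powersetSum_add, powersetSum_const_mul,
      powersetSum_ite_mem_card hl (fun s => if s < k then f s - c else 0), ← sum_range_ite_lt hk]
    simp only [mul_ite, mul_zero]
  · intro S hS
    have h1 : (S ∩ Y).card ≤ S.card := card_le_card inter_subset_left
    have h2 : smallest k S ⊆ X := (filter_subset _ _).trans hS
    have e : ∑ l ∈ smallest k S, y l = ∑ l ∈ X, if l ∈ smallest k S then y l else 0 := by
      rw [← sum_filter, filter_mem_eq_inter, inter_eq_right.2 h2]
    by_cases h : S.card < k
    · rw [if_pos (by omega), e, smallest_of_card_le h.le, mul_sum]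
      refine sum_congr rfl fun l _ => ?_
      simp only [h, if_true, show (S ∩ Y).card < k + 1 by omega, true_and]
      split_ifs <;> ring
    · rw [hf _ (not_lt.1 h), e]
      simp only [h, if_false, ite_self, add_zero]
      split_ifs with h3
      · rw [mul_sum]
        refine sum_congr rfl fun l _ => ?_
        simp only [h3, true_and]
        split_ifs <;> ring
      · simp [h3]

lemma filter_lt_eq_inter {N i : ℕ} {S : Finset ℕ} (hS : S ⊆ Icc 1 N) :
    S.filter (· < i) = S ∩ Icc 1 (i - 1) := by
  ext j
  simp only [mem_filter, mem_inter, mem_Icc]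
  constructor
  · rintro ⟨h1, h2⟩
    have := mem_Icc.1 (hS h1)
    exact ⟨h1, by omega⟩
  · rintro ⟨h1, h2⟩
    exact ⟨h1, by omega⟩

lemma card_filter_lt_lt_and_mem_smallest_iff_of_lt {k l i : ℕ} {S : Finset ℕ} (hli : l < i) :
    ((S.filter (· < i)).card < k + 1 ∧ l ∈ smallest k S)
      ↔ l ∈ S ∧ (S.filter (· < i)).card < k + 1 := by
  rw [mem_smallest]
  constructor
  · tauto
  · rintro ⟨h1, h2⟩
    have := card_filter_lt_lt_card_filter_lt h1 hli
    exact ⟨h2, h1, by omega⟩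

/-- For `l` beyond `i`, ranking among the `k` smallest already bounds the number of points before
`i`. The strict bound `k + 1` arises because `l` itself is counted. -/
lemma card_filter_lt_lt_and_mem_smallest_iff_of_gt {k l i : ℕ} {S : Finset ℕ} (hli : i < l) :
    ((S.filter (· < i)).card < k + 1 ∧ l ∈ smallest k S)
      ↔ l ∈ S ∧ (S.filter (· < l + 1)).card < k + 1 := by
  have key : l ∈ S → (S.filter (· < l + 1)).card = (S.filter (· < l)).card + 1 := fun h => by
    rw [← card_insert_of_notMem (a := l) (by simp)]
    congr 1
    ext j
    simp only [mem_filter, mem_insert]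
    constructor
    · rintro ⟨h1, h2⟩
      by_cases h3 : j = l
      · exact Or.inl h3
      · exact Or.inr ⟨h1, by omega⟩
    · rintro (rfl | ⟨h1, h2⟩)
      · exact ⟨h, by omega⟩
      · exact ⟨h1, by omega⟩
  have := card_filter_lt_mono S hli.le
  rw [mem_smallest]
  constructor
  · rintro ⟨_, h1, h2⟩
    exact ⟨h1, by rw [key h1]; omega⟩
  · rintro ⟨h1, h2⟩
    rw [key h1] at h2
    exact ⟨by omega, h1, by omega⟩

lemma Icc_sdiff_pair {N i : ℕ} (hi : 1 ≤ i) (hN : i + 1 ≤ N) :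
    Icc 1 N \ {i, i + 1} = Icc 1 (i - 1) ∪ Icc (i + 2) N := by
  ext j
  simp only [mem_sdiff, mem_Icc, mem_insert, mem_singleton, mem_union]
  omega

lemma card_Icc_sdiff_pair {N i : ℕ} (hi : 1 ≤ i) (hN : i + 1 ≤ N) :
    (Icc 1 N \ {i, i + 1}).card = N - 2 := by
  rw [Icc_sdiff_pair hi hN, card_union_of_disjoint, Nat.card_Icc, Nat.card_Icc]
  · omega
  · rw [disjoint_left]
    intro j
    simp only [mem_Icc]
    omega

/-! ### Evaluation of the three coefficients. -/

section Coefficients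

variable {N k i : ℕ}

/-- The inverse number of neighbours that are averaged when a point joins `s` other ones. -/
noncomputable def invNumNeighbors (k s : ℕ) : ℝ := 1 / ((min (k + 1) (s + 1) : ℕ) : ℝ)

lemma invNumNeighbors_of_le {k s : ℕ} (h : k ≤ s) : invNumNeighbors k s = 1 / ((k : ℝ) + 1) := by
  rw [invNumNeighbors, min_eq_left (by omega)]; push_cast; rfl

lemma invNumNeighbors_of_lt {k s : ℕ} (h : s < k) : invNumNeighbors k s = 1 / ((s : ℝ) + 1) := by
  rw [invNumNeighbors, min_eq_right (by omega)]; push_cast; rfl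

lemma powersetSum_ite_card_filter_lt (hi : 1 ≤ i) (hiN : i + 1 ≤ N) (hk : k + 1 ≤ N)
    {f : ℕ → ℝ} {c : ℝ} (hf : ∀ s, k ≤ s → f s = c) :
    powersetSum (Icc 1 N \ {i, i + 1})
        (fun S => if (S.filter (· < i)).card < k + 1 then f S.card else 0)
      = c * (((N : ℝ) - 1) * min ((k : ℝ) + 1) i / i) + ∑ s ∈ range k, (f s - c) := by
  have hY : Icc 1 (i - 1) ⊆ Icc 1 N \ {i, i + 1} := by
    rw [Icc_sdiff_pair hi hiN]; exact subset_union_left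
  have hcard := card_Icc_sdiff_pair hi hiN
  rw [powersetSum_congr (fun S hS => by rw [filter_lt_eq_inter (hS.trans sdiff_subset)]),
    powersetSum_ite_card_inter_mul hY (by omega) hf, hcard, Nat.card_Icc, Nat.cast_sub (by omega)]
  have h1 : i - 1 + 1 - 1 + 1 = i := by omega
  have h2 : ((i - 1 + 1 - 1 : ℕ) : ℝ) + 1 = i := by exact_mod_cast h1
  rw [h1, h2]
  push_cast
  ring

lemma powersetSum_mul_eq_coeffA₁ (hi : 1 ≤ i) (hiN : i + 1 ≤ N) (hk : k + 1 ≤ N) :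
    powersetSum (Icc 1 N \ {i, i + 1}) (fun S =>
        if (S.filter (· < i)).card < k + 1 then invNumNeighbors k S.card ^ 2 else 0)
      = coeffA₁ N (k + 1) i := by
  rw [powersetSum_ite_card_filter_lt hi hiN hk (f := fun s => invNumNeighbors k s ^ 2)
    (c := (1 / ((k : ℝ) + 1)) ^ 2) (fun s hs => by simp only [invNumNeighbors_of_le hs]), coeffA₁,
    sum_Icc_one_eq_sum_range, sum_range_succ, sum_sub_distrib,
    sum_congr rfl (fun s hs => by rw [invNumNeighbors_of_lt (mem_range.1 hs)])]
  simp only [sum_const, card_range, nsmul_eq_mul, Nat.cast_add, Nat.cast_one, one_div, inv_pow]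
  field_simp
  ring

lemma powersetSum_mul_eq_coeffA₃ (hi : 1 ≤ i) (hiN : i + 1 ≤ N) (hk : k + 1 ≤ N) :
    powersetSum (Icc 1 N \ {i, i + 1}) (fun S =>
        if (S.filter (· < i)).card < k + 1 then invNumNeighbors k S.card else 0)
      = coeffA₃ N (k + 1) i := by
  rw [powersetSum_ite_card_filter_lt hi hiN hk (f := fun s => invNumNeighbors k s)
    (c := 1 / ((k : ℝ) + 1)) (fun s hs => invNumNeighbors_of_le hs), coeffA₃,
    sum_Icc_one_eq_sum_range, sum_range_succ, sum_sub_distrib,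
    sum_congr rfl (fun s hs => by rw [invNumNeighbors_of_lt (mem_range.1 hs)])]
  simp only [sum_const, card_range, nsmul_eq_mul, Nat.cast_add, Nat.cast_one, one_div]
  field_simp
  ring

lemma powersetSum_ite_mem_smallest_of_lt (hi : 1 ≤ i) (hiN : i + 1 ≤ N) {l : ℕ}
    (hl : l ∈ Icc 1 (i - 1)) :
    powersetSum (Icc 1 N \ {i, i + 1}) (fun S =>
        if (S ∩ Icc 1 (i - 1)).card < k + 1 ∧ l ∈ smallest k S then 1 else 0)
      = ((N : ℝ) - 1) * min ((k : ℝ) + 1) i * min (k : ℝ) ((i : ℝ) - 1)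
          / (2 * ((i : ℝ) - 1) * i) := by
  have hl' := mem_Icc.1 hl
  have hY : Icc 1 (i - 1) ⊆ Icc 1 N \ {i, i + 1} := by
    rw [Icc_sdiff_pair hi hiN]; exact subset_union_left
  rw [powersetSum_congr (h := fun S => if l ∈ S ∧ (S ∩ Icc 1 (i - 1)).card < k + 1 then 1 else 0),
    powersetSum_ite_mem_card_inter hY hl, card_Icc_sdiff_pair hi hiN, Nat.card_Icc,
    Nat.cast_sub (by omega)]
  · have h1 : i - 1 + 1 - 1 + 1 = i := by omega
    have h2 : ((i - 1 + 1 - 1 : ℕ) : ℝ) = i - 1 := by rw [eq_sub_iff_add_eq]; exact_mod_cast h1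
    rw [h1, h2, show min (k : ℝ) ((i : ℝ) - 1) = min ((k : ℝ) + 1) i - 1 by
      rw [← min_sub_sub_right]; simp]
    push_cast
    ring
  · intro S hS
    rw [← filter_lt_eq_inter (hS.trans sdiff_subset)]
    simp only [card_filter_lt_lt_and_mem_smallest_iff_of_lt (show l < i by omega)]

lemma powersetSum_ite_mem_smallest_of_gt (hi : 1 ≤ i) (hiN : i + 1 ≤ N) {l : ℕ}
    (hl : l ∈ Icc (i + 2) N) :
    powersetSum (Icc 1 N \ {i, i + 1}) (fun S =>
        if (S ∩ Icc 1 (i - 1)).card < k + 1 ∧ l ∈ smallest k S then 1 else 0)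
      = ((N : ℝ) - 1) * min ((k : ℝ) + 1) ((l : ℝ) - 1) * min (k : ℝ) ((l : ℝ) - 2)
          / (2 * ((l : ℝ) - 1) * ((l : ℝ) - 2)) := by
  have hl' := mem_Icc.1 hl
  -- The relevant window is everything up to and including `l`, without the two compared points. It
  -- has `l - 2` elements, hence the denominators `l - 1` and `l - 2`.
  have hY : Icc 1 l \ {i, i + 1} ⊆ Icc 1 N \ {i, i + 1} :=
    sdiff_subset_sdiff (Icc_subset_Icc_right hl'.2) subset_rfl
  have hlY : l ∈ Icc 1 l \ {i, i + 1} := by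
    simp only [mem_sdiff, mem_Icc, mem_insert, mem_singleton]
    omega
  rw [powersetSum_congr (h := fun S =>
      if l ∈ S ∧ (S ∩ (Icc 1 l \ {i, i + 1})).card < k + 1 then 1 else 0),
    powersetSum_ite_mem_card_inter hY hlY, card_Icc_sdiff_pair hi hiN,
    card_Icc_sdiff_pair hi (by omega), Nat.cast_sub (by omega), Nat.cast_min]
  · have h2 : ((l - 2 : ℕ) : ℝ) = l - 2 := by rw [Nat.cast_sub (by omega)]; rfl
    rw [show min (k : ℝ) ((l : ℝ) - 2) = min ((k : ℝ) + 1) ((l : ℝ) - 1) - 1 by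
      rw [← min_sub_sub_right]; congr 1 <;> ring]
    push_cast
    rw [h2, show (l : ℝ) - 2 + 1 = l - 1 by ring]
    ring
  · intro S hS
    have e : S ∩ (Icc 1 l \ {i, i + 1}) = S.filter (· < l + 1) := by
      rw [filter_lt_eq_inter (hS.trans sdiff_subset), Nat.add_sub_cancel]
      ext j
      simp only [mem_inter, mem_sdiff]
      exact ⟨fun h => ⟨h.1, h.2.1⟩, fun h => ⟨h.1, h.2, (mem_sdiff.1 (hS h.1)).2⟩⟩
    rw [← filter_lt_eq_inter (hS.trans sdiff_subset), e]
    simp only [card_filter_lt_lt_and_mem_smallest_iff_of_gt (show i < l by omega)]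

lemma powersetSum_mul_eq_coeffA₂ (hi : 1 ≤ i) (hiN : i + 1 ≤ N) (hk : k + 1 ≤ N) (y : ℕ → ℝ) :
    powersetSum (Icc 1 N \ {i, i + 1}) (fun S =>
        if (S.filter (· < i)).card < k + 1 then
          invNumNeighbors k S.card ^ 2 * ∑ l ∈ smallest k S, y l else 0)
      = coeffA₂ N (k + 1) y i := by
  have hcard := card_Icc_sdiff_pair hi hiN
  have hdisj : Disjoint (Icc 1 (i - 1)) (Icc (i + 2) N) := by
    rw [disjoint_left]
    intro j
    simp only [mem_Icc]
    omega
  have hB : ∑ s ∈ range k, (s : ℝ) / ((N - 2 : ℕ) : ℝ)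
        * (invNumNeighbors k s ^ 2 - (1 / ((k : ℝ) + 1)) ^ 2)
      = 1 / ((N : ℝ) - 2) * (∑ j ∈ Icc 1 k, (j : ℝ) / ((j : ℝ) + 1) ^ 2)
        - 1 / ((k : ℝ) + 1) ^ 2 * (k * ((k : ℝ) + 1) / (2 * ((N : ℝ) - 2))) := by
    -- The term `s = 0` vanishes. The added term `s = k` is offset by the constant part, turning `k
    -- * (k - 1) / 2` into `k * (k + 1) / 2`.
    have h1 : ∑ j ∈ Icc 1 k, (j : ℝ) / ((j : ℝ) + 1) ^ 2
        = (∑ s ∈ range k, (s : ℝ) / ((s : ℝ) + 1) ^ 2) + k / ((k : ℝ) + 1) ^ 2 := by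
      rw [sum_Icc_one_eq_sum_range, ← sum_range_succ (fun s : ℕ => (s : ℝ) / ((s : ℝ) + 1) ^ 2),
        sum_range_succ' (fun s : ℕ => (s : ℝ) / ((s : ℝ) + 1) ^ 2)]
      simp
    have h2 : ∀ s ∈ range k, (s : ℝ) / ((N - 2 : ℕ) : ℝ)
        * (invNumNeighbors k s ^ 2 - (1 / ((k : ℝ) + 1)) ^ 2)
        = ((N : ℝ) - 2)⁻¹ * (s / ((s : ℝ) + 1) ^ 2 - (1 / ((k : ℝ) + 1)) ^ 2 * s) := by
      intro s hs
      rw [invNumNeighbors_of_lt (mem_range.1 hs), Nat.cast_sub (by omega)]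
      generalize hu : (s : ℝ) + 1 = u
      push_cast
      ring
    rw [sum_congr rfl h2, ← mul_sum, sum_sub_distrib, ← mul_sum, sum_range_cast, h1]
    generalize ∑ s ∈ range k, (s : ℝ) / ((s : ℝ) + 1) ^ 2 = A
    rw [div_eq_mul_inv _ (2 * ((N : ℝ) - 2)), mul_inv, one_div ((N : ℝ) - 2)]
    generalize ((N : ℝ) - 2)⁻¹ = B
    field_simp
    ring
  rw [powersetSum_congr (fun S hS => by rw [filter_lt_eq_inter (hS.trans sdiff_subset)]),
    powersetSum_ite_card_inter_mul_sum (by omega) (f := fun s => invNumNeighbors k s ^ 2)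
      (c := (1 / ((k : ℝ) + 1)) ^ 2) (fun s hs => by simp only [invNumNeighbors_of_le hs]),
    hcard, hB, coeffA₂, Icc_sdiff_pair hi hiN, sum_union hdisj, sum_union hdisj,
    ← Icc_sdiff_pair hi hiN,
    sum_congr rfl (fun l hl => by rw [powersetSum_ite_mem_smallest_of_lt hi hiN hl]),
    sum_congr (s₁ := Icc (i + 2) N) rfl
      (fun l hl => by rw [powersetSum_ite_mem_smallest_of_gt hi hiN hl]), ← sum_mul]
  have hsplit : ∀ u : ℕ → ℝ, ∀ b d e : ℝ, ∑ l ∈ Icc (i + 2) N, y l * (d * u l + (b - d * e))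
      = (∑ l ∈ Icc (i + 2) N, y l) * b + d * ∑ l ∈ Icc (i + 2) N, y l * (u l - e) := by
    intro u b d e
    rw [sum_mul, mul_sum, ← sum_add_distrib]
    exact sum_congr rfl fun l _ => by ring
  rw [one_div_pow, hsplit]
  simp only [Nat.add_sub_cancel, Nat.cast_add, Nat.cast_one, add_sub_cancel_right]
  ring

end Coefficients

/-! ### Consecutive differences and the farthest point. -/

lemma shapleyValue_sortedUtility_sub {N k i : ℕ} (hi : 1 ≤ i) (hiN : i + 1 ≤ N) (hk : k + 1 ≤ N)
    (y : ℕ → ℝ) (t : ℝ) :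
    shapleyValue (Icc 1 N) (sortedUtility (k + 1) y t) i
        - shapleyValue (Icc 1 N) (sortedUtility (k + 1) y t) (i + 1)
      = (y (i + 1) - y i) / ((N : ℝ) - 1) *
        ((y i + y (i + 1)) * coeffA₁ N (k + 1) i + 2 * coeffA₂ N (k + 1) y i
          - 2 * t * coeffA₃ N (k + 1) i) := by
  have hI : Icc 1 N = insert i (insert (i + 1) (Icc 1 N \ {i, i + 1})) := by
    ext j
    simp only [mem_sdiff, mem_Icc, mem_insert, mem_singleton]
    omega
  have h1 : i ∉ Icc 1 N \ {i, i + 1} := by simp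
  have h2 : i + 1 ∉ Icc 1 N \ {i, i + 1} := by simp
  have := shapleyValue_insert_insert_sub h1 h2 (by omega) (sortedUtility (k + 1) y t)
  rw [← hI] at this
  rw [this, powersetSum_congr (fun S hS => sortedUtility_insert_sub (fun h => h1 (hS h))
      (fun h => h2 (hS h)) y t), powersetSum_const_mul]
  simp only [sub_eq_add_neg, ← neg_mul]
  rw [powersetSum_add, powersetSum_add, powersetSum_const_mul, powersetSum_const_mul,
    powersetSum_const_mul, ← powersetSum_mul_eq_coeffA₁ hi hiN hk,
    ← powersetSum_mul_eq_coeffA₂ hi hiN hk, ← powersetSum_mul_eq_coeffA₃ hi hiN hk,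
    card_Icc_sdiff_pair hi hiN, Nat.cast_sub (by omega)]
  simp only [invNumNeighbors]
  push_cast
  rw [show (N : ℝ) - 2 + 1 = N + -1 by ring]
  ring

/-- All of `S` precedes `N`, so below size `k + 1` the neighbours are `S` before and `insert N S`
after, and from that size on nothing changes. The empty set is separate because its utility is
prescribed and `1 / S.card` is not meaningful there. -/
lemma sortedUtility_insert_last_sub {N k : ℕ} {S : Finset ℕ} (hS : S ⊆ Icc 1 (N - 1)) (hN : 1 ≤ N)
    (y : ℕ → ℝ) (t : ℝ) :
    sortedUtility (k + 1) y t (insert N S) - sortedUtility (k + 1) y t S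
      = (if S.card = 0 then t ^ 2 - (y N - t) ^ 2 else 0)
        + ((if 1 ≤ S.card ∧ S.card < k + 1 then
              1 / (S.card : ℝ) ^ 2 - 1 / ((S.card : ℝ) + 1) ^ 2 else 0) * (∑ l ∈ S, y l) ^ 2
          + (if 1 ≤ S.card ∧ S.card < k + 1 then
              2 * t * (1 / ((S.card : ℝ) + 1) - 1 / S.card) - 2 * y N / ((S.card : ℝ) + 1) ^ 2
              else 0) * ∑ l ∈ S, y l)
        + (if 1 ≤ S.card ∧ S.card < k + 1 then
            (y N / ((S.card : ℝ) + 1) - 2 * t) * (-(y N / ((S.card : ℝ) + 1))) else 0) := by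
  have hNS : N ∉ S := fun h => by have := mem_Icc.1 (hS h); omega
  have hf : S.filter (· < N) = S := filter_true_of_mem fun j hj => by
    have := mem_Icc.1 (hS hj); omega
  rw [sortedUtility, sortedUtility, card_insert_of_notMem hNS, if_neg (Nat.succ_ne_zero _)]
  by_cases h0 : S.card = 0
  · obtain rfl := card_eq_zero.1 h0
    have : smallest (k + 1) {N} = {N} := smallest_of_card_le (by simp)
    simp [this]
    ring
  · by_cases hk : S.card < k + 1
    · rw [smallest_insert_of_lt hNS (by rwa [hf]), smallest_of_card_le (show S.card ≤ k by omega),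
        smallest_of_card_le hk.le, sum_insert hNS, min_eq_right (by omega), min_eq_right hk.le]
      simp only [if_neg h0, if_pos (show 1 ≤ S.card ∧ S.card < k + 1 by omega)]
      push_cast
      generalize (S.card : ℝ) + 1 = u
      ring
    · rw [smallest_insert_of_le hNS (by rw [hf]; omega), min_eq_left (by omega),
        min_eq_left (by omega)]
      simp [h0, hk]

lemma shapleyValue_sortedUtility_last {N k : ℕ} (hN : 3 ≤ N) (hk : k + 1 ≤ N)
    (y : ℕ → ℝ) (t : ℝ) :
    shapleyValue (Icc 1 N) (sortedUtility (k + 1) y t) N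
      = 1 / (N : ℝ) * lastPointSum N (k + 1) y t
        + 1 / (N : ℝ) * (t ^ 2 - (y N - t) ^ 2) := by
  have hI : (Icc 1 N).erase N = Icc 1 (N - 1) := by
    ext j
    simp only [mem_erase, mem_Icc]
    omega
  have hcard : (Icc 1 (N - 1)).card = N - 1 := by simp
  rw [shapleyValue_eq_powersetSum (by simp; omega), hI,
    powersetSum_congr (fun S hS => sortedUtility_insert_last_sub hS (by omega) y t),
    powersetSum_add, powersetSum_add, powersetSum_add,
    powersetSum_card _ (fun s => if s = 0 then t ^ 2 - (y N - t) ^ 2 else 0),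
    powersetSum_card_mul_sum_sq _ y (fun s => if 1 ≤ s ∧ s < k + 1 then
      1 / (s : ℝ) ^ 2 - 1 / ((s : ℝ) + 1) ^ 2 else 0),
    powersetSum_card_mul_sum _ y (fun s => if 1 ≤ s ∧ s < k + 1 then
      2 * t * (1 / ((s : ℝ) + 1) - 1 / s) - 2 * y N / ((s : ℝ) + 1) ^ 2 else 0),
    powersetSum_card _ (fun s => if 1 ≤ s ∧ s < k + 1 then
      (y N / ((s : ℝ) + 1) - 2 * t) * (-(y N / ((s : ℝ) + 1))) else 0),
    hcard, show N - 1 + 1 = N by omega, Nat.card_Icc, Nat.add_sub_cancel, ← mul_add]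
  congr 1
  rw [sum_ite_eq' (range N) 0, if_pos (mem_range.2 (by omega)), add_assoc, add_comm]
  congr 1
  -- The size-zero term has been split off, so only sizes from 1 to `k` remain.
  have hset : (range N).filter (fun s => 1 ≤ s ∧ s < k + 1) = Icc 1 k := by
    ext s
    simp only [mem_filter, mem_range, mem_Icc]
    omega
  rw [← sum_add_distrib, ← sum_add_distrib, lastPointSum, Nat.add_sub_cancel, ← hset, sum_filter]
  refine sum_congr rfl fun s _ => ?_
  split_ifs with hs
  · have h1 : (s : ℝ) ≠ 0 := by have := hs.1; positivity
    have h2 : (s : ℝ) + 1 ≠ 0 := by positivity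
    have hN' : (3 : ℝ) ≤ N := by exact_mod_cast hN
    have h3 : (N : ℝ) - 1 ≠ 0 := by linarith
    have h4 : (N : ℝ) - 2 ≠ 0 := by linarith
    rw [Nat.cast_sub (by omega), Nat.cast_one, show (N : ℝ) - 1 - 1 = N - 2 by ring]
    have e1 : (s : ℝ) / (N - 1) - s * (s - 1) / ((N - 1) * (N - 2))
        = s * (N - s - 1) / ((N - 1) * (N - 2)) := by field_simp; ring
    have e2 : 1 / (s : ℝ) ^ 2 - 1 / ((s : ℝ) + 1) ^ 2 = (2 * s + 1) / (s ^ 2 * (s + 1) ^ 2) := by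
      field_simp; ring
    have e3 : 2 * t * (1 / ((s : ℝ) + 1) - 1 / s) - 2 * y N / ((s : ℝ) + 1) ^ 2
        = -(2 * y N) / ((s : ℝ) + 1) ^ 2 - 2 * t / (s * (s + 1)) := by
      field_simp; ring
    rw [e1, e2, e3]
    ring
  · ring

theorem theorem5 {E : Type*} [NormedAddCommGroup E] (N K : ℕ) (hN : 3 ≤ N) (hK : 1 ≤ K)
    (x : ℕ → E) (y : ℕ → ℝ) (xtest : E) (ytest : ℝ)
    (hsorted : MonotoneOn (fun i => ‖x i - xtest‖) (Set.Icc 1 N))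
    (φ : ℕ → ℝ)
    (hφ : φ = shapleyValue (Finset.Icc 1 N) (knnRegressionUtility K x y xtest ytest)) :
    (∀ i : ℕ, 1 ≤ i → i + 1 ≤ N →
      φ i - φ (i + 1) = (y (i + 1) - y i) / ((N : ℝ) - 1) *
        ((y i + y (i + 1)) * coeffA₁ N (min K N) i + 2 * coeffA₂ N (min K N) y i
          - 2 * ytest * coeffA₃ N (min K N) i)) ∧
    φ N = 1 / (N : ℝ) * lastPointSum N (min K N) y ytest
      + 1 / (N : ℝ) * (ytest ^ 2 - (y N - ytest) ^ 2) := by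
  obtain ⟨k, hk⟩ : ∃ k, min K N = k + 1 := ⟨min K N - 1, by omega⟩
  have hkN : k + 1 ≤ N := by omega
  have hφ' : ∀ i ∈ Finset.Icc 1 N,
      φ i = shapleyValue (Finset.Icc 1 N) (sortedUtility (k + 1) y ytest) i := fun i hi => by
    rw [hφ, ← hk]
    exact shapleyValue_congr hi
      fun S hS => knnRegressionUtility_eq_sortedUtility K y ytest hsorted hS
  rw [hk]
  refine ⟨fun i hi hiN => ?_, ?_⟩
  · rw [hφ' i (by simp; omega), hφ' (i + 1) (by simp; omega)]
    exact shapleyValue_sortedUtility_sub hi hiN hkN y ytest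
  · rw [hφ' N (by simp; omega)]
    exact shapleyValue_sortedUtility_last hN hkN y ytest
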